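/- **Theorem 2.2 (Shelah's Fundamental Theorem of Stability).** Let $L$ be a first-order language, $T$ an $L$-theory, and $\varphi(x,y)$ an $L$-formula, where $x$ and $y$ are finite tuples of variables, of lengths $m$ and $n$. Models are non-empty. *Definitions.* Let $M$ be a model of $T$. The formula $\varphi$ has the order property in $M$ if there are sequences $(a_i)_{i\in\mathbb N}$ in $M^m$ and $(b_j)_{j\in\mathbb N}$ in $M^n$ such that, for all $i,j$, $M\models\varphi(a_i,b_j)$ if and only if $i<j$. The formula $\varphi$ is stable in $T$ if it does not have the order property in any model of $T$. A $\varphi$-type over $M$ is a set of formulas of the form $\varphi(x,b)$ or $\neg\varphi(x,b)$ with $b\in M^n$ that is consistent, i.e. has a common solution in some elementary extension of $M$. It is complete if it is not properly contained in another $\varphi$-type over $M$, and $S_\varphi(M)$ is the set of complete $\varphi$-types over $M$. A formula $\psi(y)$ with parameters in $M$ defines $p\in S_\varphi(M)$ if, for every $b\in M^n$, $\varphi(x,b)\in p$ if and only if $M\models\psi(b)$; the type $p$ is definable over $M$ if some such $\psi$ defines it. The following are equivalent: 1. $\varphi(x,y)$ is stable in $T$. 2. For every model $M$ of $T$, every $p\in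 S_\varphi(M)$ is definable over $M$. 3. For every model $M$ of $T$, every $p\in S_\varphi(M)$ is defined by a finite Boolean combination of formulas $\varphi(a,y)$ with $a\in M^m$. 4. For every model $M$ of $T$, $|S_\varphi(M)|\le|M^m|$. (When $m=1$ this says $|S_\varphi(M)|\le|M|$.) 5. For every infinite model $M$ of $T$, $|S_\varphi(M)|\le|M|$. -/

import Mathlib

open FirstOrder Cardinal

universe u v w

namespace LocalStability

variable {L : FirstOrder.Language.{u, v}} {m n : ℕ}

/-- `φ(x, y)` has the order property in `M`: there are sequences `(a_i)`, `(b_j)` of tuples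
from `M` such that `φ(a_i, b_j)` holds in `M` exactly when `i < j`. -/
def HasOrderProperty (φ : L.Formula (Fin m ⊕ Fin n)) (M : Type w) [L.Structure M] : Prop :=
  ∃ (a : ℕ → Fin m → M) (b : ℕ → Fin n → M),
    ∀ i j : ℕ, φ.Realize (Sum.elim (a i) (b j)) ↔ i < j

/-- `φ(x, y)` is stable in the theory `T`: it has the order property in no model of `T`. -/
def IsStableIn (T : L.Theory) (φ : L.Formula (Fin m ⊕ Fin n)) : Prop :=
  ∀ M : FirstOrder.Language.Theory.ModelType.{u, v, max u v w} T, ¬ HasOrderProperty φ M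

/-- The instance `φ(x, b)`, a formula in the variables `x` with parameters from `M`. -/
def instX (φ : L.Formula (Fin m ⊕ Fin n)) {M : Type w} (b : Fin n → M) :
    L[[M]].Formula (Fin m) :=
  ((L.lhomWithConstants M).onFormula φ).subst
    (Sum.elim (fun i => FirstOrder.Language.Term.var i)
      (fun j => FirstOrder.Language.Constants.term (L.con (b j))))

/-- The instance `φ(a, y)`, a formula in the variables `y` with parameters from `M`. -/
def instY (φ : L.Formula (Fin m ⊕ Fin n)) {M : Type w} (a : Fin m → M) :
    L[[M]].Formula (Fin n) :=
  ((L.lhomWithConstants M).onFormula φ).subst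
    (Sum.elim (fun i => FirstOrder.Language.Constants.term (L.con (a i)))
      (fun j => FirstOrder.Language.Term.var j))

/-- A `φ`-type over `M`: a set of formulas of the form `φ(x, b)` or `¬φ(x, b)`, `b` from `M`,
which is consistent, that is, has a common solution in some elementary extension `N` of `M`
(equivalently, in some model `N` of the elementary diagram of `M`). -/
def IsPhiType (φ : L.Formula (Fin m ⊕ Fin n)) (M : Type w) [L.Structure M]
    (p : Set (L[[M]].Formula (Fin m))) : Prop :=
  (∀ θ ∈ p, ∃ b : Fin n → M, θ = instX φ b ∨ θ = (instX φ b).not) ∧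
    ∃ (N : FirstOrder.Language.Theory.ModelType.{max u w, v, max u v w}
        (L.elementaryDiagram M)) (c : Fin m → N), ∀ θ ∈ p, θ.Realize c

/-- `S_φ(M)`: the set of complete (that is, maximal) `φ`-types over `M`. -/
def completePhiTypes (φ : L.Formula (Fin m ⊕ Fin n)) (M : Type w) [L.Structure M] :
    Set (Set (L[[M]].Formula (Fin m))) :=
  {p | Maximal (IsPhiType φ M) p}

/-- The formula `ψ(y)`, with parameters from `M`, defines the `φ`-type `p`:
for every `b` from `M`, `φ(x, b)` belongs to `p` if and only if `ψ(b)` holds in `M`. -/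
def Defines (φ : L.Formula (Fin m ⊕ Fin n)) {M : Type w} [L.Structure M]
    (ψ : L[[M]].Formula (Fin n)) (p : Set (L[[M]].Formula (Fin m))) : Prop :=
  ∀ b : Fin n → M, instX φ b ∈ p ↔ ψ.Realize b

/-- `ψ(y)` is a finite Boolean combination of formulas `φ(a, y)` with `a` from `M`. -/
inductive IsBoolComb (φ : L.Formula (Fin m ⊕ Fin n)) (M : Type w) :
    L[[M]].Formula (Fin n) → Prop
  | inst (a : Fin m → M) : IsBoolComb φ M (instY φ a)
  | not {ψ : L[[M]].Formula (Fin n)} : IsBoolComb φ M ψ → IsBoolComb φ M ψ.not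
  | and {ψ χ : L[[M]].Formula (Fin n)} :
      IsBoolComb φ M ψ → IsBoolComb φ M χ → IsBoolComb φ M (ψ ⊓ χ)
  | or {ψ χ : L[[M]].Formula (Fin n)} :
      IsBoolComb φ M ψ → IsBoolComb φ M χ → IsBoolComb φ M (ψ ⊔ χ)

end LocalStability

/-!
Fix a model `M` and write `R a b` for `M ⊨ φ(a, b)`. A complete `φ`-type `p` over `M` is the trace
of a tuple of an elementary extension, so it is known from the set `P` of those `b` with
`φ(x, b) ∈ p`, and by elementarity `P` agrees on each finite set of parameters with some row
`{b | R a b}`, `a` from `M`.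

*Stable implies definable by Boolean combinations.* `P` is a finite Boolean combination of rows iff
membership in `P` depends on finitely many rows only (`DeterminedBy`). If it does not, a sequence
construction followed by Ramsey's theorem
(`FinitelyApproximable.exists_order_of_not_determinedBy`) gives tuples in `M` with
`R (a i) (b j) ↔ i < j`, or with `R (a i) (b j) ↔ j ≤ i`. The second order is reversed by passing
to an ultrapower (`exists_model_order`), so `φ` is unstable in either case.

*Counting.* Over infinitely many rows there are as many finite sets of rows, and finite families of
such sets, as rows; this bounds the number of types. If there are only finitely many tuples `a`, a
finitely approximable set is itself a row (`mk_completePhiTypes_le`).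

*Unstable implies many types.* Let `κ ≥ |L| + ℵ₀`. There is a linear order with more than `κ` points
that are separated by `κ` of them (`exists_linearOrder_separated`). Some model of `T` carries
tuples `a i`, `b i` ordered along it, and an elementary substructure of size `κ` containing the
separating `b j` sees more than `κ` types (`exists_many_types`). This contradicts the bound on the
number of types, and also definability, as there are only `κ` formulas with parameters.
-/

namespace LocalStability


/-! ### Relations: determined sets, orders and Ramsey's theorem -/

/-- `P` is determined by the finite set `s` of rows of the relation `R` if membership in `P`
depends only on the trace `{a ∈ s | R a b}`; equivalently, `P` is a finite Boolean combination of
the sets `{b | R a b}` with `a ∈ s`. -/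
def DeterminedBy {A B : Type*} (R : A → B → Prop) (s : Finset A) (P : Set B) : Prop :=
  ∀ b b' : B, (∀ a ∈ s, R a b ↔ R a b') → (b ∈ P ↔ b' ∈ P)

theorem DeterminedBy.mono {A B : Type*} {R : A → B → Prop} {s t : Finset A} {P : Set B}
    (h : DeterminedBy R s P) (hst : s ⊆ t) : DeterminedBy R t P :=
  fun b b' hb => h b b' fun a ha => hb a (hst ha)

/-- A determined set is coded by a finite set `s` of rows and a finite family of subsets
of `s`, so over infinitely many rows there are no more determined sets than rows. -/
theorem mk_determinedBy_le {A B : Type w} [Infinite A] (R : A → B → Prop) :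
    #{P : Set B // ∃ s, DeterminedBy R s P} ≤ #A := by
  classical
  choose s hs using fun P : {P : Set B // ∃ s, DeterminedBy R s P} => P.2
  let code : {P : Set B // ∃ s, DeterminedBy R s P} → Finset A × Finset (Finset A) := fun P =>
    (s P, (s P).powerset.filter fun t => ∃ b ∈ P.1, t = (s P).filter (R · b))
  have mem_code : ∀ P b, b ∈ P.1 ↔ (code P).1.filter (R · b) ∈ (code P).2 := by
    intro P b
    simp only [code, Finset.mem_filter, Finset.mem_powerset, Finset.filter_subset, true_and]
    refine ⟨fun hb => ⟨b, hb, rfl⟩, fun ⟨b', hb', h⟩ => (hs P b b' fun a ha => ?_).2 hb'⟩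
    have := congrArg (fun t : Finset A => a ∈ t) h
    simpa [ha] using this
  have inj : Function.Injective code := by
    intro P Q h
    ext b
    rw [mem_code, mem_code, h]
  refine (mk_le_of_injective inj).trans ?_
  rw [mk_prod, lift_id, lift_id, mk_finset_of_infinite, mk_finset_of_infinite,
    mk_finset_of_infinite, mul_eq_self (aleph0_le_mk A)]

/-- Infinite Ramsey theorem for pairs and two colours. -/
theorem exists_strictMono_homogeneous (c : ℕ → ℕ → Prop) :
    ∃ g : ℕ → ℕ, StrictMono g ∧
      ((∀ i j, i < j → c (g i) (g j)) ∨ ∀ i j, i < j → ¬ c (g i) (g j)) := by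
  -- A nonprincipal ultrafilter decides the colour of almost all pairs; that colour can then be
  -- realized along a sequence chosen greedily.
  have key : ∀ d : ℕ → ℕ → Prop,
      (∀ᶠ x in Filter.hyperfilter ℕ, ∀ᶠ y in Filter.hyperfilter ℕ, d x y) →
      ∃ g : ℕ → ℕ, StrictMono g ∧ ∀ i j, i < j → d (g i) (g j) := by
    intro d hd
    obtain ⟨g, -, hg⟩ := exists_seq_of_forall_finset_exists
      (fun x => ∀ᶠ y in Filter.hyperfilter ℕ, d x y) (fun x y => x < y ∧ d x y) (by
        intro s hs
        have h : ∀ᶠ y in Filter.hyperfilter ℕ, ∀ x ∈ s, x < y ∧ d x y := by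
          rw [Filter.eventually_all_finset]
          exact fun x hx => ((Filter.eventually_gt_atTop x).filter_mono
            Nat.hyperfilter_le_atTop).and (hs x hx)
        exact (hd.and h).exists)
    exact ⟨g, fun i j h => (hg i j h).1, fun i j h => (hg i j h).2⟩
  by_cases h : ∀ᶠ x in Filter.hyperfilter ℕ, ∀ᶠ y in Filter.hyperfilter ℕ, c x y
  · obtain ⟨g, hg, h⟩ := key c h
    exact ⟨g, hg, .inl h⟩
  · simp only [← Ultrafilter.eventually_not] at h
    obtain ⟨g, hg, h⟩ := key (fun x y => ¬ c x y) h
    exact ⟨g, hg, .inr h⟩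

/-- On each finite set of points, `P` agrees with some row `{b | R a b}` of `R`. -/
def FinitelyApproximable {A B : Type*} (R : A → B → Prop) (P : Set B) : Prop :=
  ∀ t : Finset B, ∃ a, ∀ b ∈ t, R a b ↔ b ∈ P

/-- Over finitely many rows, a finitely approximable set is itself a row. -/
theorem FinitelyApproximable.exists_row {A B : Type*} [Finite A] {R : A → B → Prop} {P : Set B}
    (h : FinitelyApproximable R P) : ∃ a, ∀ b, R a b ↔ b ∈ P := by
  classical
  have := Fintype.ofFinite A
  by_contra! hne
  choose f hf using hne
  obtain ⟨a, ha⟩ := h (Finset.univ.image f)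
  have := ha (f a) (Finset.mem_image_of_mem f (Finset.mem_univ a))
  have := hf a
  tauto

/-- The combinatorial core of definability of types. If no finite set of rows determines `P`, pick
inductively `b i ∈ P` and `b' i ∉ P` with the same trace on the earlier rows, and a row `a i` that
agrees with `P` on all points chosen so far. On a homogeneous subsequence one of `b`, `b'` is
ordered by the rows. -/
theorem FinitelyApproximable.exists_order_of_not_determinedBy {A B : Type*} {R : A → B → Prop}
    {P : Set B} (h : FinitelyApproximable R P) (hP : ∀ s, ¬ DeterminedBy R s P) :
    ∃ (a : ℕ → A) (b : ℕ → B),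
      (∀ i j, R (a i) (b j) ↔ i < j) ∨ ∀ i j, R (a i) (b j) ↔ j ≤ i := by
  classical
  have split : ∀ s : Finset A, ∃ b ∈ P, ∃ b' ∉ P, ∀ a ∈ s, R a b ↔ R a b' := by
    intro s
    have := hP s
    simp only [DeterminedBy, not_forall] at this
    obtain ⟨b, b', hbb, hne⟩ := this
    by_cases hb : b ∈ P
    · exact ⟨b, hb, b', by tauto, hbb⟩
    · exact ⟨b', by tauto, b, hb, fun a ha => (hbb a ha).symm⟩
  obtain ⟨f, hf, hr⟩ := exists_seq_of_forall_finset_exists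
    (fun x : A × B × B => (R x.1 x.2.1 ∧ ¬ R x.1 x.2.2) ∧ x.2.1 ∈ P ∧ x.2.2 ∉ P)
    (fun x y => (R y.1 x.2.1 ∧ ¬ R y.1 x.2.2) ∧ (R x.1 y.2.1 ↔ R x.1 y.2.2)) (by
      intro s hs
      obtain ⟨b, hb, b', hb', hbb⟩ := split (s.image Prod.fst)
      obtain ⟨a, ha⟩ := h ({b, b'} ∪ s.image (fun x => x.2.1) ∪ s.image (fun x => x.2.2))
      refine ⟨(a, b, b'), ⟨⟨(ha b (by simp)).2 hb, fun h => hb' ((ha b' (by simp)).1 h)⟩, hb, hb'⟩,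
        fun x hx => ⟨⟨(ha _ ?_).2 (hs x hx).2.1, fun h => (hs x hx).2.2 ((ha _ ?_).1 h)⟩,
          hbb _ (Finset.mem_image_of_mem _ hx)⟩⟩
      · exact Finset.mem_union_left _ (Finset.mem_union_right _
          (Finset.mem_image_of_mem (fun x : A × B × B => x.2.1) hx))
      · exact Finset.mem_union_right _ (Finset.mem_image_of_mem (fun x : A × B × B => x.2.2) hx))
  have lower : ∀ i j, j ≤ i → R (f i).1 (f j).2.1 ∧ ¬ R (f i).1 (f j).2.2 := by
    intro i j hij
    rcases hij.eq_or_lt with rfl | hij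
    · exact (hf j).1
    · exact (hr j i hij).1
  obtain ⟨g, hg, hc | hc⟩ := exists_strictMono_homogeneous fun i j => R (f i).1 (f j).2.1
  · refine ⟨fun i => (f (g i)).1, fun j => (f (g j)).2.2, .inl fun i j => ⟨fun hR => ?_, fun hij =>
      (hr _ _ (hg hij)).2.1 (hc i j hij)⟩⟩
    by_contra! hij
    exact (lower _ _ (hg.monotone hij)).2 hR
  · refine ⟨fun i => (f (g i)).1, fun j => (f (g j)).2.1, .inr fun i j => ⟨fun hR => ?_, fun hij =>
      (lower _ _ (hg.monotone hij)).1⟩⟩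
    by_contra! hij
    exact hc i j hij hR

/-! ### A linear order with more points than cuts needed to separate them -/

/-- For every infinite `κ` there is a linear order with more than `κ` points in which at most `κ`
points separate all others: the lexicographic order on `2 ^ μ`, where `μ` is least with `κ < 2 ^ μ`,
with the points that take the value `1` a last time. -/
theorem exists_linearOrder_separated (κ : Cardinal.{w}) (hκ : ℵ₀ ≤ κ) :
    ∃ (I : Type w) (_ : LinearOrder I) (J : Set I), #J ≤ κ ∧ κ < #I ∧
      ∀ i i' : I, i < i' → ∃ j ∈ J, i < j ∧ j ≤ i' := by
  obtain ⟨μ, hμ, hmin⟩ := exists_minimal_of_wellFoundedLT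
    (fun μ : Cardinal.{w} => κ < 2 ^ μ) ⟨κ, cantor κ⟩
  have hμκ : μ ≤ κ := by
    by_contra! h
    exact (hmin (cantor κ) h.le).not_gt h
  let D := μ.ord.ToType
  let F : (Σ ξ : D, (Set.Iio ξ → Bool)) → Lex (D → Bool) := fun x =>
    toLex fun η => if h : η < x.1 then x.2 ⟨η, h⟩ else decide (η = x.1)
  refine ⟨Lex (D → Bool), inferInstance, Set.range F, mk_range_le.trans ?_, ?_, ?_⟩
  · rw [mk_sigma]
    calc Cardinal.sum (fun ξ : D => #(Set.Iio ξ → Bool)) ≤ Cardinal.sum fun _ : D => κ := by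
          refine sum_le_sum _ _ fun ξ => ?_
          -- Initial segments of `D` are smaller than `μ`, so minimality of `μ` bounds `2 ^ #(Iio ξ)`.
          have : #(Set.Iio ξ) < μ := (mk_Iio_lt ξ (by simp [D])).trans_eq (by simp [D])
          by_contra! h
          refine (hmin (y := #(Set.Iio ξ)) ?_ this.le).not_gt this
          simpa using h
      _ = μ * κ := by simp [D]
      _ ≤ κ * κ := by gcongr
      _ = κ := mul_eq_self hκ
  · calc κ < 2 ^ μ := hμ
      _ = #(D → Bool) := by simp [D]
      _ = #(Lex (D → Bool)) := rfl
  · rintro f g ⟨ξ, hlt, hξ⟩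
    obtain ⟨hf, hg⟩ := Bool.lt_iff.1 hξ
    -- The separating point agrees with `f` and `g` below `ξ`, is `1` at `ξ` and `0` above.
    have F_lt : ∀ η < ξ, F ⟨ξ, fun η => f η⟩ η = f η := fun η hη => dif_pos hη
    have F_ge : ∀ η, ¬ η < ξ → F ⟨ξ, fun η => f η⟩ η = decide (η = ξ) := fun η hη => dif_neg hη
    refine ⟨_, ⟨⟨ξ, fun η => f η⟩, rfl⟩, ⟨ξ, fun η hη => (F_lt η hη).symm, ?_⟩, ?_⟩
    · refine Bool.lt_iff.2 ⟨hf, ?_⟩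
      simp [F_ge ξ (lt_irrefl ξ)]
    · by_contra! hlt'
      obtain ⟨ζ, -, hζ⟩ := hlt'
      obtain ⟨hgζ, hFζ⟩ := Bool.lt_iff.1 hζ
      by_cases h : ζ < ξ
      · have h1 := hlt ζ h
        have h2 := F_lt ζ h
        simp_all
      · have h2 := F_ge ζ h
        simp_all


/-! ### Complete `φ`-types as traces of tuples in elementary extensions -/

section Types

open FirstOrder.Language

variable {L : FirstOrder.Language.{u, v}} {m n : ℕ}

theorem realize_instX_con {φ : L.Formula (Fin m ⊕ Fin n)} {M N : Type*} [L.Structure N]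
    [L[[M]].Structure N] [(L.lhomWithConstants M).IsExpansionOn N] {a : Fin m → N}
    {b : Fin n → M} :
    (instX φ b).Realize a ↔ φ.Realize (Sum.elim a fun j => (L.con (b j) : N)) := by
  rw [← LHom.realize_onFormula (L.lhomWithConstants M), instX]
  refine BoundedFormula.realize_subst.trans ?_
  rw [Formula.Realize]
  refine iff_of_eq (congrArg₂ _ (funext ?_) rfl)
  rintro (i | j)
  · rfl
  · exact Term.realize_constants

theorem realize_instX {φ : L.Formula (Fin m ⊕ Fin n)} {M : Type*} [L.Structure M]
    {a : Fin m → M} {b : Fin n → M} :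
    (instX φ b).Realize a ↔ φ.Realize (Sum.elim a b) :=
  realize_instX_con

theorem realize_instY {φ : L.Formula (Fin m ⊕ Fin n)} {M : Type*} [L.Structure M]
    {a : Fin m → M} {b : Fin n → M} :
    (instY φ a).Realize b ↔ φ.Realize (Sum.elim a b) := by
  rw [← LHom.realize_onFormula (L.lhomWithConstants M), instY]
  refine BoundedFormula.realize_subst.trans ?_
  rw [Formula.Realize]
  refine iff_of_eq (congrArg₂ _ (funext ?_) rfl)
  rintro (i | j)
  · exact Term.realize_constants
  · rfl

/-- Truth of `φ(a, b)` as a relation between tuples of `M`. -/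
def Holds (φ : L.Formula (Fin m ⊕ Fin n)) (M : Type*) [L.Structure M]
    (a : Fin m → M) (b : Fin n → M) : Prop :=
  φ.Realize (Sum.elim a b)

/-- The set of parameters `b` with `φ(x, b) ∈ p`. -/
def positivePart (φ : L.Formula (Fin m ⊕ Fin n)) {M : Type*} (p : Set (L[[M]].Formula (Fin m))) :
    Set (Fin n → M) :=
  {b | instX φ b ∈ p}

/-- The `φ`-type over `M` of a tuple `c` from a structure `N` for the language with constants
for `M`. -/
def phiTypeOf (φ : L.Formula (Fin m ⊕ Fin n)) (M : Type*) {N : Type*} [L[[M]].Structure N]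
    (c : Fin m → N) : Set (L[[M]].Formula (Fin m)) :=
  {θ | (∃ b : Fin n → M, θ = instX φ b ∨ θ = (instX φ b).not) ∧ θ.Realize c}

theorem instX_mem_phiTypeOf {φ : L.Formula (Fin m ⊕ Fin n)} {M N : Type*} [L[[M]].Structure N]
    {c : Fin m → N} {b : Fin n → M} : instX φ b ∈ phiTypeOf φ M c ↔ (instX φ b).Realize c :=
  and_iff_right ⟨b, .inl rfl⟩

/-- The type of a tuple is maximal, since it contains one of `φ(x, b)`, `¬φ(x, b)` for each `b`. -/
theorem phiTypeOf_mem_completePhiTypes (φ : L.Formula (Fin m ⊕ Fin n)) (M : Type w) [L.Structure M]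
    (N : FirstOrder.Language.Theory.ModelType.{max u w, v, max u v w} (L.elementaryDiagram M))
    (c : Fin m → N) : phiTypeOf φ M c ∈ completePhiTypes φ M := by
  refine ⟨⟨fun θ hθ => hθ.1, N, c, fun θ hθ => hθ.2⟩, fun q ⟨hq, N', c', hc'⟩ hsub θ hθ => ?_⟩
  refine ⟨hq θ hθ, ?_⟩
  obtain ⟨b, rfl | rfl⟩ := hq θ hθ
  · by_contra hb
    have := hc' _ (hsub (a := (instX φ b).not) ⟨⟨b, .inr rfl⟩, hb⟩)
    exact this (hc' _ hθ)
  · intro hb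
    exact hc' _ hθ (hc' _ (hsub (instX_mem_phiTypeOf.2 hb)))

theorem exists_eq_phiTypeOf {φ : L.Formula (Fin m ⊕ Fin n)} {M : Type w} [L.Structure M]
    {p : Set (L[[M]].Formula (Fin m))} (hp : p ∈ completePhiTypes φ M) :
    ∃ (N : FirstOrder.Language.Theory.ModelType.{max u w, v, max u v w} (L.elementaryDiagram M))
      (c : Fin m → N), p = phiTypeOf φ M c := by
  obtain ⟨hform, N, c, hc⟩ := hp.1
  exact ⟨N, c, hp.eq_of_subset (phiTypeOf_mem_completePhiTypes φ M N c).1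
    fun θ hθ => ⟨hform θ hθ, hc θ hθ⟩⟩

theorem positivePart_injOn (φ : L.Formula (Fin m ⊕ Fin n)) (M : Type w) [L.Structure M] :
    Set.InjOn (positivePart φ) (completePhiTypes φ M) := by
  intro p hp q hq h
  obtain ⟨N, c, rfl⟩ := exists_eq_phiTypeOf hp
  obtain ⟨N', c', rfl⟩ := exists_eq_phiTypeOf hq
  have key : ∀ b, (instX φ b).Realize c ↔ (instX φ b).Realize c' := fun b => by
    rw [← instX_mem_phiTypeOf (M := M), ← instX_mem_phiTypeOf (M := M)]
    exact Set.ext_iff.1 h b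
  ext θ
  refine and_congr_right fun ⟨b, hb⟩ => ?_
  obtain rfl | rfl := hb
  · exact key b
  · exact not_congr (key b)

theorem realize_iExs_relabel {L' : FirstOrder.Language} {χ : L'.Formula (Fin m)} {K : Type*}
    [L'.Structure K] :
    Sentence.Realize K (Formula.iExs (Fin m) (χ.relabel Sum.inr) : L'.Sentence) ↔
      ∃ x : Fin m → K, χ.Realize x := by
  rw [Sentence.Realize, Formula.realize_iExs]
  simp only [Formula.realize_relabel, Sum.elim_comp_inr]

/-- The finitely many conditions that a `φ`-type imposes on a finite set of parameters are
expressed by one existential sentence with parameters in `M`, so they are met in `M` itself. -/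
theorem finitelyApproximable_positivePart {φ : L.Formula (Fin m ⊕ Fin n)} {M : Type w}
    [L.Structure M] {p : Set (L[[M]].Formula (Fin m))} (hp : p ∈ completePhiTypes φ M) :
    FinitelyApproximable (Holds φ M) (positivePart φ p) := by
  classical
  obtain ⟨N, c, rfl⟩ := exists_eq_phiTypeOf hp
  intro t
  let f : t → L[[M]].Formula (Fin m) := fun b =>
    if instX φ b.1 ∈ phiTypeOf φ M c then instX φ b.1 else (instX φ b.1).not
  let σ : L[[M]].Sentence := Formula.iExs (Fin m) ((Formula.iInf f).relabel Sum.inr)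
  have hN : N ⊨ σ := by
    refine realize_iExs_relabel.2 ⟨c, Formula.realize_iInf.2 fun b => ?_⟩
    by_cases hb : instX φ b.1 ∈ phiTypeOf φ M c
    · simpa [f, hb] using hb.2
    · simp only [f, hb, if_false, Formula.realize_not]
      rwa [← instX_mem_phiTypeOf]
  obtain ⟨a, ha⟩ := realize_iExs_relabel.1 ((realize_iff_of_model_completeTheory M N σ).1 hN)
  refine ⟨a, fun b hb => ?_⟩
  have hab := Formula.realize_iInf.1 ha ⟨b, hb⟩
  refine realize_instX.symm.trans ?_
  change _ ↔ instX φ b ∈ phiTypeOf φ M c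
  by_cases h : instX φ b ∈ phiTypeOf φ M c
  · simpa [f, h] using hab
  · simpa [f, h] using hab

/-- A set determined by finitely many rows is defined by a Boolean combination of instances
`φ(a, y)`. Nonemptiness of `M` provides an instance from which to form the constants true and
false. -/
theorem exists_isBoolComb_of_determinedBy {φ : L.Formula (Fin m ⊕ Fin n)} {M : Type w}
    [L.Structure M] [Nonempty M] (s : Finset (Fin m → M)) :
    ∀ P : Set (Fin n → M), DeterminedBy (Holds φ M) s P →
      ∃ ψ : L[[M]].Formula (Fin n), IsBoolComb φ M ψ ∧ ∀ b, b ∈ P ↔ ψ.Realize b := by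
  classical
  induction s using Finset.induction_on with
  | empty =>
    intro P hP
    obtain ⟨a⟩ : Nonempty (Fin m → M) := inferInstance
    by_cases h : ∃ b, b ∈ P
    · obtain ⟨b, hb⟩ := h
      refine ⟨instY φ a ⊔ (instY φ a).not, .or (.inst a) (.not (.inst a)), fun b' => ?_⟩
      simp [(hP b b' (by simp)).1 hb, em]
    · push Not at h
      refine ⟨instY φ a ⊓ (instY φ a).not, .and (.inst a) (.not (.inst a)), fun b' => ?_⟩
      simp [h b']
  | insert a s _ ih =>
    intro P hP
    -- `P` splits into the parts with `φ(a, b)` true and false, each the trace of a set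
    -- determined by `s`.
    have part : ∀ Q : Set (Fin n → M), ∃ ψ : L[[M]].Formula (Fin n), IsBoolComb φ M ψ ∧
        ∀ b, (∃ b' ∈ Q, ∀ x ∈ s, Holds φ M x b ↔ Holds φ M x b') ↔ ψ.Realize b := by
      intro Q
      refine ih {b | ∃ b' ∈ Q, ∀ x ∈ s, Holds φ M x b ↔ Holds φ M x b'} fun b₁ b₂ h => ?_
      refine exists_congr fun b' => and_congr_right fun _ => forall₂_congr fun x hx => ?_
      rw [h x hx]
    obtain ⟨ψ₁, hψ₁, h₁⟩ := part {b ∈ P | Holds φ M a b}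
    obtain ⟨ψ₀, hψ₀, h₀⟩ := part {b ∈ P | ¬ Holds φ M a b}
    refine ⟨(instY φ a ⊓ ψ₁) ⊔ ((instY φ a).not ⊓ ψ₀),
      .or (.and (.inst a) hψ₁) (.and (.not (.inst a)) hψ₀), fun b => ?_⟩
    rw [Formula.realize_sup, Formula.realize_inf, Formula.realize_inf, Formula.realize_not,
      realize_instY, ← h₁, ← h₀]
    change _ ↔ Holds φ M a b ∧ _ ∨ ¬ Holds φ M a b ∧ _
    constructor
    · intro hb
      by_cases ha : Holds φ M a b
      · exact .inl ⟨ha, b, ⟨hb, ha⟩, fun _ _ => Iff.rfl⟩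
      · exact .inr ⟨ha, b, ⟨hb, ha⟩, fun _ _ => Iff.rfl⟩
    · rintro (⟨ha, b', ⟨hb', ha'⟩, h⟩ | ⟨ha, b', ⟨hb', ha'⟩, h⟩)
      all_goals
        refine (hP b b' fun x hx => ?_).2 hb'
        rcases Finset.mem_insert.1 hx with rfl | hx
        · simp only [ha, ha']
        · exact h x hx

theorem IsBoolComb.exists_determinedBy {φ : L.Formula (Fin m ⊕ Fin n)} {M : Type w}
    [L.Structure M] {ψ : L[[M]].Formula (Fin n)} (hψ : IsBoolComb φ M ψ) :
    ∃ s, DeterminedBy (Holds φ M) s {b | ψ.Realize b} := by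
  classical
  induction hψ with
  | inst a =>
    refine ⟨{a}, fun b b' h => ?_⟩
    exact realize_instY.trans ((h a (by simp)).trans realize_instY.symm)
  | not _ ih =>
    obtain ⟨s, hs⟩ := ih
    exact ⟨s, fun b b' h => not_congr (hs b b' h)⟩
  | and _ _ ih₁ ih₂ =>
    obtain ⟨s₁, hs₁⟩ := ih₁
    obtain ⟨s₂, hs₂⟩ := ih₂
    refine ⟨s₁ ∪ s₂, fun b b' h => ?_⟩
    have h₁ := hs₁.mono Finset.subset_union_left b b' h
    have h₂ := hs₂.mono Finset.subset_union_right b b' h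
    simpa using and_congr h₁ h₂
  | or _ _ ih₁ ih₂ =>
    obtain ⟨s₁, hs₁⟩ := ih₁
    obtain ⟨s₂, hs₂⟩ := ih₂
    refine ⟨s₁ ∪ s₂, fun b b' h => ?_⟩
    have h₁ := hs₁.mono Finset.subset_union_left b b' h
    have h₂ := hs₂.mono Finset.subset_union_right b b' h
    simpa using or_congr h₁ h₂

/-- If every positive part is determined by finitely many instances `φ(a, y)`, there are no more
complete `φ`-types than `m`-tuples. Over finitely many tuples each type is realized in `M`. -/
theorem mk_completePhiTypes_le {φ : L.Formula (Fin m ⊕ Fin n)} {M : Type (max u v w)}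
    [L.Structure M]
    (h : ∀ p ∈ completePhiTypes φ M, ∃ s, DeterminedBy (Holds φ M) s (positivePart φ p)) :
    #(completePhiTypes φ M) ≤ #(Fin m → M) := by
  cases finite_or_infinite (Fin m → M) with
  | inl _ =>
    choose a ha using fun p : completePhiTypes φ M =>
      (finitelyApproximable_positivePart p.2).exists_row
    refine mk_le_of_injective (f := a) fun p q hpq => Subtype.ext ?_
    refine positivePart_injOn φ M p.2 q.2 (Set.ext fun b => ?_)
    rw [← ha, ← ha, hpq]
  | inr _ =>
    refine le_trans (mk_le_of_injective (f := fun p => ⟨positivePart φ p.1, h p.1 p.2⟩)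
      fun p q hpq => Subtype.ext ?_) (mk_determinedBy_le (Holds φ M))
    exact positivePart_injOn φ M p.2 q.2 (congrArg Subtype.val hpq)

end Types


/-! ### Transfer of orders by ultrapowers -/

section Orders

open FirstOrder.Language

variable {L : FirstOrder.Language.{u, v}} {m n : ℕ}

/-- If `φ` orders arbitrarily long finite sequences in a model of `T`, then it orders sequences
indexed by any given linear order `I` in some model of `T`: an ultrapower over the finite subsets
`s` of `I`, where coordinate `s` uses the rank in `s` as index. -/
theorem exists_model_order {T : L.Theory} {φ : L.Formula (Fin m ⊕ Fin n)}
    (M : FirstOrder.Language.Theory.ModelType.{u, v, max u v w} T)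
    (hM : ∀ k : ℕ, ∃ (a : ℕ → Fin m → M) (b : ℕ → Fin n → M),
      ∀ i ≤ k, ∀ j ≤ k, Holds φ M (a i) (b j) ↔ i < j)
    (I : Type (max u v w)) [LinearOrder I] :
    ∃ (N : FirstOrder.Language.Theory.ModelType.{u, v, max u v w} T)
      (a : I → Fin m → N) (b : I → Fin n → N), ∀ i j, Holds φ N (a i) (b j) ↔ i < j := by
  classical
  choose a b hab using hM
  let U : Ultrafilter (Finset I) := Ultrafilter.of Filter.atTop
  let N := (U : Filter (Finset I)).Product fun _ => M
  let rank (s : Finset I) (i : I) : ℕ := (s.filter (· < i)).card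
  have rank_le : ∀ s i, rank s i ≤ s.card := fun s i => Finset.card_filter_le _ _
  have rank_lt : ∀ s i j, i ∈ s → (rank s i < rank s j ↔ i < j) := by
    intro s i j hi
    constructor
    · contrapose!
      exact fun h => Finset.card_le_card
        (Finset.monotone_filter_right s fun x _ hx => lt_of_lt_of_le hx h)
    · intro h
      refine Finset.card_lt_card (Finset.ssubset_iff_of_subset
        (Finset.monotone_filter_right s fun x _ hx => lt_trans hx h) |>.2 ⟨i, ?_, ?_⟩)
      · simpa using ⟨hi, h⟩
      · simp
  have hT : N ⊨ T := ⟨fun σ hσ => (Ultraproduct.sentence_realize σ).2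
    (Filter.Eventually.of_forall fun _ => T.realize_sentence_of_mem hσ)⟩
  refine ⟨Theory.ModelType.of T N,
    fun i x => ((fun s => a s.card (rank s i) x : Finset I → M) : N),
    fun j y => ((fun s => b s.card (rank s j) y : Finset I → M) : N), fun i j => ?_⟩
  have key : ∀ᶠ s in (U : Filter (Finset I)),
      Holds φ M (a s.card (rank s i)) (b s.card (rank s j)) ↔ i < j := by
    refine Filter.Eventually.filter_mono (Ultrafilter.of_le _)
      ((Filter.eventually_ge_atTop {i}).mono fun s hs => ?_)
    rw [hab _ _ (rank_le s i) _ (rank_le s j), rank_lt s i j (hs (by simp))]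
  have los := Ultraproduct.realize_formula_cast (u := U) φ
    (Sum.elim (fun x s => a s.card (rank s i) x) (fun y s => b s.card (rank s j) y))
  refine Iff.trans ?_ (los.trans ((Filter.eventually_congr
    (key.mono fun s hs => Iff.trans ?_ hs)).trans Filter.eventually_const))
  · refine iff_of_eq (congrArg φ.Realize (funext ?_))
    rintro (x | y) <;> rfl
  · refine iff_of_eq (congrArg φ.Realize (funext ?_))
    rintro (x | y) <;> rfl

/-- Finite pieces of sequences ordered by `j ≤ i`, read backwards and with the second sequence
shifted by one, are ordered by `i < j`; an ultrapower turns them into infinite sequences. -/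
theorem not_isStableIn_of_reverse_order {T : L.Theory} {φ : L.Formula (Fin m ⊕ Fin n)}
    (M : FirstOrder.Language.Theory.ModelType.{u, v, max u v w} T)
    (a : ℕ → Fin m → M) (b : ℕ → Fin n → M) (h : ∀ i j, Holds φ M (a i) (b j) ↔ j ≤ i) :
    ¬ IsStableIn.{u, v, w} T φ := by
  obtain ⟨N, a', b', hN⟩ := exists_model_order.{u, v, w} (φ := φ) M (fun k =>
    ⟨fun i => a (k - i), fun j => b (k + 1 - j), fun i hi j hj => by rw [h]; omega⟩)
    (ULift.{max u v w} ℕ)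
  exact fun hs => hs N ⟨fun i => a' ⟨i⟩, fun j => b' ⟨j⟩, fun i j => hN ⟨i⟩ ⟨j⟩⟩

/-! ### A model with many types -/

/-- A structure is a model of the elementary diagram of each of its elementary substructures, the
constants being interpreted by themselves. -/
theorem model_elementaryDiagram {N : Type w} [L.Structure N] (S : L.ElementarySubstructure N) :
    let _ := constantsOn.structure (fun x : S => (x : N))
    N ⊨ L.elementaryDiagram S := by
  intro
  refine ⟨fun σ hσ => ?_⟩
  have h := (Formula.realize_equivSentence_symm_con S σ).2 hσ
  exact (Formula.realize_equivSentence_symm_con N σ).1 ((S.subtype.map_formula _ _).2 h)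

/-- An unstable formula has more types than parameters over some model `M` of size at least that of
the language. Order tuples `a i`, `b i` of a model along a linear order with more than `κ` points;
an elementary substructure of size `κ` containing the `b j` of a separating set of `κ` points
distinguishes the types of all the `a i`. -/
theorem exists_many_types {T : L.Theory} {φ : L.Formula (Fin m ⊕ Fin n)}
    (h : ¬ IsStableIn.{u, v, w} T φ) :
    ∃ M : FirstOrder.Language.Theory.ModelType.{u, v, max u v w} T, Infinite M ∧
      Cardinal.lift.{w} L.card ≤ #M ∧ #M < #(completePhiTypes φ M) := by
  simp only [IsStableIn, not_forall, not_not] at h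
  obtain ⟨M₀, a₀, b₀, h₀⟩ := h
  let κ : Cardinal.{max u v w} := max ℵ₀ (Cardinal.lift.{w} L.card)
  have hκ : ℵ₀ ≤ κ := le_max_left _ _
  obtain ⟨I, _, J, hJ, hI, hsep⟩ := exists_linearOrder_separated κ hκ
  obtain ⟨N, a, b, hN⟩ := exists_model_order.{u, v, w} M₀
    (fun _ => ⟨a₀, b₀, fun i _ j _ => h₀ i j⟩) I
  have a_inj : Function.Injective a := by
    refine Function.Injective.of_lt_imp_ne fun i i' hii h => ?_
    obtain ⟨j, -, hij, hji⟩ := hsep i i' hii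
    exact hji.not_gt ((hN i' j).1 (h ▸ (hN i j).2 hij))
  have hκN : κ ≤ #N := by
    by_contra! hlt
    refine ((mk_le_of_injective a_inj).trans ?_).not_gt hI
    calc #(Fin m → N) = #N ^ m := by simp
      _ ≤ max #N ℵ₀ := power_nat_le_max
      _ ≤ κ := max_le hlt.le hκ
  obtain ⟨S, hS, hSκ⟩ := exists_elementarySubstructure_card_eq L
    (Set.range fun x : J × Fin n => b x.1 x.2) κ hκ
    (by
      rw [lift_le]
      refine mk_range_le.trans ?_
      rw [mk_prod, lift_id', mk_fin, lift_natCast]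
      exact mul_le_of_le hκ (by simpa using hJ) (natCast_le_aleph0.trans hκ))
    (by
      rw [← lift_lift.{w, max u v, max u v}, lift_le]
      exact le_max_right _ _)
    (by simpa using hκN)
  rw [lift_inj] at hSκ
  let M : FirstOrder.Language.Theory.ModelType.{u, v, max u v w} T := S.toModel T
  have hMκ : #M = κ := hSκ
  let _ : (constantsOn M).Structure N := constantsOn.structure (fun x : S => (x : N))
  have : N ⊨ L.elementaryDiagram M := model_elementaryDiagram S
  let p : I → completePhiTypes φ M := fun i =>
    ⟨_, phiTypeOf_mem_completePhiTypes φ M (Theory.ModelType.of (L.elementaryDiagram M) N) (a i)⟩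
  have mem_p : ∀ j ∈ J, ∃ c : Fin n → M, ∀ i, instX φ c ∈ (p i).1 ↔ i < j := by
    intro j hj
    refine ⟨fun y => ⟨b j y, hS ⟨(⟨j, hj⟩, y), rfl⟩⟩, fun i => ?_⟩
    have real : ∀ c : Fin n → M, (instX φ c).Realize (a i) ↔ Holds φ N (a i) fun y => (c y).1 :=
      fun c => realize_instX_con
    exact instX_mem_phiTypeOf.trans ((real _).trans (hN i j))
  have p_inj : Function.Injective p := by
    refine Function.Injective.of_lt_imp_ne fun i i' hii h => ?_
    obtain ⟨j, hj, hij, hji⟩ := hsep i i' hii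
    obtain ⟨c, hc⟩ := mem_p j hj
    exact hji.not_gt ((hc i').1 (h ▸ (hc i).2 hij))
  refine ⟨M, infinite_iff.2 (hMκ ▸ hκ), hMκ ▸ le_max_right _ _, ?_⟩
  rw [hMκ]
  exact hI.trans_le (mk_le_of_injective p_inj)

end Orders


/-! ### Definability of types of a stable formula -/

section Definability

open FirstOrder.Language

variable {L : FirstOrder.Language.{u, v}} {m n : ℕ}

/-- Types of a stable formula depend on finitely many instances `φ(a, y)` with `a` from `M`. -/
theorem IsStableIn.exists_determinedBy {T : L.Theory} {φ : L.Formula (Fin m ⊕ Fin n)}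
    (h : IsStableIn.{u, v, w} T φ)
    (M : FirstOrder.Language.Theory.ModelType.{u, v, max u v w} T)
    {p : Set (L[[M]].Formula (Fin m))} (hp : p ∈ completePhiTypes φ M) :
    ∃ s, DeterminedBy (Holds φ M) s (positivePart φ p) := by
  by_contra! hs
  obtain ⟨a, b, hab | hab⟩ :=
    (finitelyApproximable_positivePart hp).exists_order_of_not_determinedBy hs
  · exact h M ⟨a, b, hab⟩
  · exact not_isStableIn_of_reverse_order M a b hab h

/-- Distinct complete types have distinct definitions, so definability bounds their number by the
number of formulas with parameters. -/
theorem mk_completePhiTypes_le_of_definable {φ : L.Formula (Fin m ⊕ Fin n)}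
    {M : Type (max u v w)} [L.Structure M] [Infinite M] (hL : Cardinal.lift.{w} L.card ≤ #M)
    (h : ∀ p ∈ completePhiTypes φ M, ∃ ψ : L[[M]].Formula (Fin n), Defines φ ψ p) :
    #(completePhiTypes φ M) ≤ #M := by
  choose ψ hψ using fun p : completePhiTypes φ M => h p.1 p.2
  have inj : Function.Injective ψ := by
    intro p q hpq
    refine Subtype.ext (positivePart_injOn φ M p.2 q.2 (Set.ext fun b => ?_))
    exact (hψ p b).trans (hpq ▸ (hψ q b).symm)
  refine (mk_le_of_injective inj).trans ?_
  have hM := aleph0_le_mk M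
  refine (mk_le_of_injective (f := fun ψ : L[[M]].Formula (Fin n) =>
    (⟨0, ψ⟩ : Σ k, L[[M]].BoundedFormula (Fin n) k))
    (fun _ _ h => eq_of_heq (Sigma.mk.inj h).2)).trans ?_
  refine BoundedFormula.card_le.trans (max_le hM (add_le_of_le hM ?_ ?_))
  · simpa using natCast_le_aleph0.trans hM
  · rw [card_withConstants, lift_add]
    refine add_le_of_le hM ?_ ?_
    · rwa [lift_uzero, lift_umax.{max u v, w}]
    · rw [lift_uzero, lift_id'.{max u v, w}]

end Definability

end LocalStability

theorem theorem2p2 {L : FirstOrder.Language.{u, v}} (T : L.Theory) {m n : ℕ}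
    (φ : L.Formula (Fin m ⊕ Fin n)) :
    List.TFAE [
      -- `φ` is stable in `T`
      LocalStability.IsStableIn.{u, v, w} T φ,
      -- every complete `φ`-type over a model is definable
      ∀ M : FirstOrder.Language.Theory.ModelType.{u, v, max u v w} T,
        ∀ p ∈ LocalStability.completePhiTypes φ M,
          ∃ ψ : L[[M]].Formula (Fin n), LocalStability.Defines φ ψ p,
      -- every complete `φ`-type over a model is definable by a Boolean combination of `φ(a, y)`
      ∀ M : FirstOrder.Language.Theory.ModelType.{u, v, max u v w} T,
        ∀ p ∈ LocalStability.completePhiTypes φ M,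
          ∃ ψ : L[[M]].Formula (Fin n),
            LocalStability.IsBoolComb φ M ψ ∧ LocalStability.Defines φ ψ p,
      -- `|S_φ(M)| ≤ |M ^ m|` for every model (for `m = 1` this is `|S_φ(M)| ≤ |M|`)
      ∀ M : FirstOrder.Language.Theory.ModelType.{u, v, max u v w} T,
        #(LocalStability.completePhiTypes φ M) ≤ #(Fin m → M),
      -- `|S_φ(M)| ≤ |M|` for every infinite model
      ∀ M : FirstOrder.Language.Theory.ModelType.{u, v, max u v w} T, Infinite M →
        #(LocalStability.completePhiTypes φ M) ≤ #M] := by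
  tfae_have 1 → 3 := by
    intro h M p hp
    obtain ⟨s, hs⟩ := h.exists_determinedBy M hp
    exact LocalStability.exists_isBoolComb_of_determinedBy s _ hs
  tfae_have 3 → 2 := by
    intro h M p hp
    obtain ⟨ψ, -, hψ⟩ := h M p hp
    exact ⟨ψ, hψ⟩
  tfae_have 2 → 1 := by
    intro h
    by_contra hs
    obtain ⟨M, hM, hL, hlt⟩ := LocalStability.exists_many_types.{u, v, w} hs
    exact (LocalStability.mk_completePhiTypes_le_of_definable.{u, v, w} hL (h M)).not_gt hlt
  tfae_have 3 → 4 := by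
    intro h M
    refine LocalStability.mk_completePhiTypes_le.{u, v, w} fun p hp => ?_
    obtain ⟨ψ, hψ, hdef⟩ := h M p hp
    obtain ⟨s, hs⟩ := hψ.exists_determinedBy
    exact ⟨s, fun b b' hb => (hdef b).trans ((hs b b' hb).trans (hdef b').symm)⟩
  tfae_have 4 → 5 := by
    intro h M hM
    refine (h M).trans ?_
    rw [mk_arrow, mk_fin, lift_natCast, lift_uzero]
    exact power_nat_le (aleph0_le_mk M)
  tfae_have 5 → 1 := by
    intro h
    by_contra hs
    obtain ⟨M, hM, -, hlt⟩ := LocalStability.exists_many_types.{u, v, w} hs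
    exact (h M hM).not_gt hlt
  tfae_finish
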